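/- Call a finite list of complex numbers \emph{realisable} if it is, up to order, the spectrum (the eigenvalues counted with algebraic multiplicity) of some entrywise nonnegative real square matrix. The \emph{Perron eigenvalue} of a realisable list is its entry $\rho = \max_i |\lambda_i|$, the maximum being taken over all entries $\lambda_i$ of the list. \textbf{Theorem.} Let $m\ge 3$ and let the list $(\rho,\ \alpha+i\beta,\ \alpha-i\beta,\ \lambda_4,\dots,\lambda_m)$ of complex numbers be realisable, where $\rho$ is its Perron eigenvalue, $\alpha$ is real and $\beta>0$. Let $a,t,\eta$ be any real numbers with $a\ge 0$, $t\ge 0$ and $0<\eta\le 1$. Then the list $$(\mu_1,\mu_2,\mu_3,\mu_4,\lambda_4,\dots,\lambda_m)$$ is realisable, where $\mu_1,\mu_2,\mu_3,\mu_4$ are the four complex roots, counted with multiplicity, of the polynomial $$q(x)=(x-\rho)\bigl((x-\alpha)^2+\beta^2\bigr)(x-a)-t\Bigl((x-\alpha)\bigl((1+\eta)x-\alpha-\eta\rho\bigr)+\beta^2\Bigr).$$ -/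

import Mathlib

/-- The spectrum of a real square matrix: the roots in `ℂ` of its characteristic polynomial,
counted with algebraic multiplicity. -/
noncomputable def matrixSpectrum {n : ℕ} (A : Matrix (Fin n) (Fin n) ℝ) : Multiset ℂ :=
  (A.map (algebraMap ℝ ℂ)).charpoly.roots

/-- A list of complex numbers is realisable if it is (up to order) the spectrum of some entrywise
nonnegative real square matrix. -/
def Realisable (σ : List ℂ) : Prop :=
  ∃ (n : ℕ) (A : Matrix (Fin n) (Fin n) ℝ),
    (∀ i j, 0 ≤ A i j) ∧ matrixSpectrum A = (σ : Multiset ℂ)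

/-- The real number `ρ` is the Perron eigenvalue of the list `σ`: it belongs to `σ` and it is the
largest modulus of an entry of `σ`. -/
def IsPerronEigenvalue (ρ : ℝ) (σ : List ℂ) : Prop :=
  (ρ : ℂ) ∈ σ ∧ ∀ z ∈ σ, ‖z‖ ≤ ρ

open Polynomial in
/-- The quartic polynomial
`q(x) = (x - ρ)((x - α)² + β²)(x - a) - t((x - α)((1 + η)x - α - ηρ) + β²)`,
viewed in `ℂ[x]`. -/
noncomputable def quarticPoly (ρ α β a η t : ℝ) : ℂ[X] :=
  (X - C (ρ : ℂ)) * ((X - C (α : ℂ)) ^ 2 + C (β : ℂ) ^ 2) * (X - C (a : ℂ))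
    - C (t : ℂ) * ((X - C (α : ℂ)) * ((1 + C (η : ℂ)) * X - C (α : ℂ) - C (η : ℂ) * C (ρ : ℂ))
        + C (β : ℂ) ^ 2)

/-! The list is realised by adding one row and one column to a matrix. By Perron–Frobenius the given
matrix can be replaced by a cospectral nonnegative `A` with all row sums `ρ`, so the all-ones vector
is an eigenvector for `ρ`. Scale an eigenvector `z` for `α + iβ` so that `z k = 1` and all `‖z j‖ ≤
1`. Border `A` with the column `1 + η Re z`, which is nonnegative since `η ≤ 1`, the row `t e_k` and
the corner `a`. The column is a combination of eigenvectors for `ρ` and `α ± iβ`, so in the Schur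
complement `(x - A)⁻¹` acts on it explicitly. The new characteristic polynomial is that of `A` times
`x - a - t (1/(x-ρ) + η(x-α)/((x-α)²+β²))`. Clearing denominators turns the factors of `ρ, α ± iβ`
into `q` and leaves the others alone. -/

/-! ### Perron vectors and reduction to constant row sums -/

open Matrix in
/-- An entrywise positive real matrix has an entrywise positive eigenvector. -/
theorem exists_pos_eigenvector {ι : Type*} [Fintype ι] [Nonempty ι] (A : Matrix ι ι ℝ)
    (hA : ∀ i j, 0 < A i j) : ∃ (r : ℝ) (w : ι → ℝ), (∀ i, 0 < w i) ∧ A *ᵥ w = r • w := by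
  classical
  have hpos : ∀ x : ι → ℝ, (∀ i, 0 ≤ x i) → (∃ i, 0 < x i) → ∀ i, 0 < (A *ᵥ x) i := by
    rintro x hx ⟨j, hj⟩ i
    exact Finset.sum_pos' (fun k _ => mul_nonneg (hA i k).le (hx k))
      ⟨j, Finset.mem_univ j, mul_pos (hA i j) hj⟩
  have hsimp : ∀ x ∈ stdSimplex ℝ ι, ∃ i, 0 < x i := by
    intro x hx
    by_contra! h
    have h1 : ∑ i, x i ≤ 0 := Finset.sum_nonpos fun i _ => h i
    linarith [hx.2]
  set M : ℝ := ∑ i, ∑ j, A i j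
  -- Collatz–Wielandt: the largest `s` with `s x ≤ A x` for some `x` in the simplex is the Perron
  -- root. The cap `M` only makes `K` compact; `hM` shows that it excludes nothing.
  set K : Set ((ι → ℝ) × ℝ) :=
    (stdSimplex ℝ ι ×ˢ Set.Icc 0 M) ∩ {p | ∀ i, p.2 * p.1 i ≤ (A *ᵥ p.1) i} with hK
  have hKc : IsCompact K := by
    refine ((isCompact_stdSimplex ℝ ι).prod isCompact_Icc).inter_right ?_
    simp only [Set.ofPred_forall]
    refine isClosed_iInter fun i => isClosed_le (by fun_prop) ?_
    simp only [mulVec, dotProduct]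
    fun_prop
  have hM : ∀ (x : ι → ℝ) (s : ℝ), x ∈ stdSimplex ℝ ι → (∀ i, s * x i ≤ (A *ᵥ x) i) → s ≤ M := by
    intro x s hx h
    have h1 : s = ∑ i, s * x i := by rw [← Finset.mul_sum, hx.2, mul_one]
    rw [h1]
    refine Finset.sum_le_sum fun i _ => (h i).trans (Finset.sum_le_sum fun j _ => ?_)
    have : x j ≤ 1 := by
      rw [← hx.2]
      exact Finset.single_le_sum (fun k _ => hx.1 k) (Finset.mem_univ j)
    exact mul_le_of_le_one_right (hA i j).le this
  have hKne : K.Nonempty := by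
    obtain ⟨i⟩ := ‹Nonempty ι›
    refine ⟨(Pi.single i 1, 0), ⟨single_mem_stdSimplex ℝ i, le_refl _,
      Finset.sum_nonneg fun i _ => Finset.sum_nonneg fun j _ => (hA i j).le⟩, fun j => ?_⟩
    simpa using (hA j i).le
  obtain ⟨⟨x, s⟩, ⟨⟨hx, hs⟩, hxs⟩, hmax⟩ := hKc.exists_isMaxOn hKne continuous_snd.continuousOn
  simp only [Set.mem_ofPred_eq] at hx hs hxs
  have hy := hpos x hx.1 (hsimp x hx)
  have heq : A *ᵥ x = s • x := by
    by_contra hne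
    obtain ⟨i₀, hi₀⟩ : ∃ i, (A *ᵥ x) i ≠ (s • x) i := by
      by_contra! h
      exact hne (funext h)
    -- Positivity of `A` makes `A (A x - s x)` strictly positive, so `y = A x`, once normalised,
    -- admits `s + ε`, against maximality of `s`.
    have hd := hpos (A *ᵥ x - s • x) (fun i => by simpa using hxs i)
      ⟨i₀, sub_pos.2 (lt_of_le_of_ne (hxs i₀) (Ne.symm hi₀))⟩
    set y := A *ᵥ x with hydef
    obtain ⟨i₁, -, hi₁⟩ := Finset.exists_min_image Finset.univ
      (fun i => (A *ᵥ (y - s • x)) i / y i) Finset.univ_nonempty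
    set ε := (A *ᵥ (y - s • x)) i₁ / y i₁
    have hε : 0 < ε := div_pos (hd i₁) (hy i₁)
    have hS : 0 < ∑ i, y i := Finset.sum_pos (fun i _ => hy i) Finset.univ_nonempty
    have hmem : (∑ i, y i)⁻¹ • y ∈ stdSimplex ℝ ι := by
      refine ⟨fun i => mul_nonneg (inv_nonneg.2 hS.le) (hy i).le, ?_⟩
      simp only [Pi.smul_apply, smul_eq_mul, ← Finset.mul_sum]
      exact inv_mul_cancel₀ hS.ne'
    have hle : ∀ i, (s + ε) * ((∑ i, y i)⁻¹ • y) i ≤ (A *ᵥ ((∑ i, y i)⁻¹ • y)) i := by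
      intro i
      have h1 : ε * y i ≤ (A *ᵥ (y - s • x)) i := (le_div_iff₀ (hy i)).1 (hi₁ i (Finset.mem_univ i))
      rw [mulVec_sub, mulVec_smul, ← hydef] at h1
      simp only [Pi.sub_apply, Pi.smul_apply, smul_eq_mul] at h1
      rw [mulVec_smul]
      simp only [Pi.smul_apply, smul_eq_mul]
      rw [mul_left_comm]
      exact mul_le_mul_of_nonneg_left (by linarith) (inv_nonneg.2 hS.le)
    have := hmax (show ((∑ i, y i)⁻¹ • y, s + ε) ∈ K from
      ⟨⟨hmem, by linarith [hs.1], hM _ _ hmem hle⟩, hle⟩)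
    simp only [Set.mem_ofPred_eq] at this
    linarith
  refine ⟨s, x, fun i => ?_, heq⟩
  have h1 := hy i
  rw [heq] at h1
  exact (pos_iff_pos_of_mul_pos h1).1 (lt_of_le_of_ne hs.1 (by rintro rfl; simp at h1))

open Matrix in
/-- An eigenvalue `r` with positive eigenvector of a nonnegative matrix is at most the sum of all
entries. -/
theorem le_sum_of_mulVec_eq_smul {ι : Type*} [Fintype ι] [Nonempty ι] {A : Matrix ι ι ℝ}
    (hA : ∀ i j, 0 ≤ A i j) {r : ℝ} {w : ι → ℝ} (hw : ∀ i, 0 < w i) (h : A *ᵥ w = r • w) :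
    r ≤ ∑ i, ∑ j, A i j := by
  -- The row at a maximal entry of `w` bounds `r`.
  obtain ⟨k, -, hk⟩ := Finset.exists_max_image Finset.univ w Finset.univ_nonempty
  have h1 : r * w k ≤ (∑ j, A k j) * w k := by
    have h2 : (A *ᵥ w) k = r * w k := by rw [h]; rfl
    rw [← h2, Finset.sum_mul]
    exact Finset.sum_le_sum fun j hj => mul_le_mul_of_nonneg_left (hk j hj) (hA k j)
  exact (le_of_mul_le_mul_right h1 (hw k)).trans
    (Finset.single_le_sum (f := fun i => ∑ j, A i j)
      (fun i _ => Finset.sum_nonneg fun j _ => hA i j) (Finset.mem_univ k))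

open Matrix Polynomial Filter Topology in
/-- Every nonnegative matrix is cospectral with a nonnegative matrix with constant row sums. -/
theorem exists_constant_rowSum_charpoly_eq {ι : Type*} [Fintype ι] [DecidableEq ι] [Nonempty ι]
    (A : Matrix ι ι ℝ) (hA : ∀ i j, 0 ≤ A i j) :
    ∃ (B : Matrix ι ι ℝ) (r : ℝ), (∀ i j, 0 ≤ B i j) ∧ (∀ i, ∑ j, B i j = r) ∧
      B.charpoly = A.charpoly := by
  -- A reducible `A` may have no positive eigenvector, hence the perturbation. The vectors `w k` may
  -- degenerate in the limit, but the rescaled matrices `B k` have entries in `[0, M]`, so a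
  -- subsequence converges.
  set E : ℕ → Matrix ι ι ℝ := fun k => Matrix.of fun i j => A i j + 1 / ((k : ℝ) + 1) with hE
  have hEpos : ∀ k i j, 0 < E k i j := fun k i j => by
    have := hA i j
    simp only [hE, of_apply]
    positivity
  choose r w hw hrw using fun k => exists_pos_eigenvector (E k) (hEpos k)
  set B : ℕ → Matrix ι ι ℝ := fun k => diagonal (w k)⁻¹ * E k * diagonal (w k) with hB
  have hBapp : ∀ k i j, B k i j = (w k i)⁻¹ * E k i j * w k j := fun k i j => by
    simp [hB, mul_diagonal, diagonal_mul]
  have hBpos : ∀ k i j, 0 ≤ B k i j := fun k i j => by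
    rw [hBapp]
    have h1 := hw k i
    have h2 := hw k j
    have h3 := hEpos k i j
    positivity
  have hBsum : ∀ k i, ∑ j, B k i j = r k := fun k i => by
    have h1 : ∑ j, E k i j * w k j = r k * w k i := congrFun (hrw k) i
    simp only [hBapp, mul_assoc]
    rw [← Finset.mul_sum, h1, mul_comm (r k), inv_mul_cancel_left₀ (hw k i).ne']
  have hBchar : ∀ k, (B k).charpoly = (E k).charpoly := fun k => by
    have h1 : diagonal (w k) * diagonal (w k)⁻¹ = (1 : Matrix ι ι ℝ) := by
      rw [diagonal_mul_diagonal, ← diagonal_one]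
      congr 1
      ext i
      exact mul_inv_cancel₀ (hw k i).ne'
    simp only [hB]
    rw [mul_assoc, charpoly_mul_comm, mul_assoc, h1, mul_one]
  set M : ℝ := ∑ i : ι, ∑ j : ι, (A i j + 1)
  have hrM : ∀ k, r k ≤ M := fun k =>
    (le_sum_of_mulVec_eq_smul (fun i j => (hEpos k i j).le) (hw k) (hrw k)).trans <|
      Finset.sum_le_sum fun i _ => Finset.sum_le_sum fun j _ => by
        simp only [hE, of_apply, add_le_add_iff_left]
        exact div_le_one_of_le₀ (by linarith [k.cast_nonneg (α := ℝ)]) (by positivity)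
  have hBM : ∀ k, B k ∈ Set.univ.pi fun _ : ι => Set.univ.pi fun _ : ι => Set.Icc (0 : ℝ) M :=
    fun k i _ j _ => ⟨hBpos k i j, le_trans
      (Finset.single_le_sum (f := fun j => B k i j) (fun j _ => hBpos k i j) (Finset.mem_univ j))
      ((hBsum k i).le.trans (hrM k))⟩
  obtain ⟨B', hB', φ, hφ, hlim⟩ := (isCompact_univ_pi fun _ : ι =>
    isCompact_univ_pi fun _ : ι => isCompact_Icc (a := (0 : ℝ)) (b := M)).tendsto_subseq hBM
  have hlim' : ∀ i j, Tendsto (fun k => B (φ k) i j) atTop (𝓝 (B' i j)) := fun i j =>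
    (tendsto_pi_nhds.1 (tendsto_pi_nhds.1 hlim i)) j
  have hsum : ∀ i, Tendsto (fun k => r (φ k)) atTop (𝓝 (∑ j, B' i j)) := fun i => by
    simp only [← hBsum _ i]
    exact tendsto_finsetSum _ fun j _ => hlim' i j
  have i₀ := Classical.arbitrary ι
  refine ⟨Matrix.of B', ∑ j, B' i₀ j, fun i j => (hB' i trivial j trivial).1,
    fun i => tendsto_nhds_unique (hsum i) (hsum i₀), ?_⟩
  have hElim : Tendsto (fun k => E (φ k)) atTop (𝓝 A) := by
    suffices h : Tendsto E atTop (𝓝 A) from h.comp hφ.tendsto_atTop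
    refine tendsto_pi_nhds.2 fun i => tendsto_pi_nhds.2 fun j => ?_
    simpa [hE] using (tendsto_const_nhds (x := A i j)).add
      (tendsto_one_div_add_atTop_nhds_zero_nat (𝕜 := ℝ))
  refine Polynomial.funext fun x => ?_
  have hcont : Continuous fun C : Matrix ι ι ℝ => C.charpoly.eval x := by
    simp only [eval_charpoly]
    fun_prop
  have h1 := (hcont.tendsto A).comp hElim
  have h2 := (hcont.tendsto (Matrix.of B')).comp (show Tendsto (fun k => B (φ k)) _ _ from hlim)
  refine tendsto_nhds_unique h2 ?_
  simpa only [Function.comp_def, hBchar] using h1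

/-! ### Eigenvectors, and the spectral radius of a matrix with constant row sums -/

open Matrix Polynomial in
/-- Every root of the characteristic polynomial of a matrix over a field has an eigenvector. -/
theorem exists_eigenvector_of_isRoot_charpoly {ι K : Type*} [Fintype ι] [DecidableEq ι] [Field K]
    {A : Matrix ι ι K} {μ : K} (h : A.charpoly.IsRoot μ) : ∃ z ≠ 0, A *ᵥ z = μ • z := by
  rw [IsRoot, eval_charpoly] at h
  obtain ⟨z, hz, h0⟩ := exists_mulVec_eq_zero_iff.2 h
  refine ⟨z, hz, ?_⟩
  rw [sub_mulVec, sub_eq_zero] at h0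
  rw [← h0]
  simp [scalar_apply, ← smul_one_eq_diagonal, smul_mulVec]

/-- A nonzero complex vector can be scaled so that its largest entry is `1`. -/
theorem exists_smul_apply_eq_one {ι : Type*} [Fintype ι] {z : ι → ℂ} (hz : z ≠ 0) :
    ∃ (c : ℂ) (k : ι), (c • z) k = 1 ∧ ∀ j, ‖(c • z) j‖ ≤ 1 := by
  obtain ⟨i, hi⟩ := Function.ne_iff.1 hz
  have : Nonempty ι := ⟨i⟩
  obtain ⟨k, -, hk⟩ := Finset.exists_max_image Finset.univ (fun j => ‖z j‖) Finset.univ_nonempty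
  have hk0 : z k ≠ 0 := norm_pos_iff.1 ((norm_pos_iff.2 hi).trans_le (hk i (Finset.mem_univ i)))
  refine ⟨(z k)⁻¹, k, by simp [hk0], fun j => ?_⟩
  simp only [Pi.smul_apply, smul_eq_mul, norm_mul, norm_inv]
  rw [inv_mul_le_iff₀ (norm_pos_iff.2 hk0), mul_one]
  exact hk j (Finset.mem_univ j)

open Matrix Polynomial in
/-- A root of the characteristic polynomial of a nonnegative matrix with constant row sums `r` has
modulus at most `r`. -/
theorem norm_le_of_isRoot_charpoly_of_rowSum {ι : Type*} [Fintype ι] [DecidableEq ι]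
    {A : Matrix ι ι ℝ} (hA : ∀ i j, 0 ≤ A i j) {r : ℝ} (hr : ∀ i, ∑ j, A i j = r) {μ : ℂ}
    (h : (A.map (algebraMap ℝ ℂ)).charpoly.IsRoot μ) : ‖μ‖ ≤ r := by
  obtain ⟨z, hz, hAz⟩ := exists_eigenvector_of_isRoot_charpoly h
  obtain ⟨c, k, hk, hle⟩ := exists_smul_apply_eq_one hz
  have h1 : ∑ j, (A k j : ℂ) * (c • z) j = μ * (c • z) k := by
    have : A.map (algebraMap ℝ ℂ) *ᵥ (c • z) = μ • (c • z) := by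
      rw [mulVec_smul, hAz, smul_comm]
    exact congrFun this k
  rw [hk, mul_one] at h1
  rw [← h1, ← hr k]
  refine (norm_sum_le _ _).trans (Finset.sum_le_sum fun j _ => ?_)
  rw [norm_mul, Complex.norm_real, Real.norm_of_nonneg (hA k j)]
  exact mul_le_of_le_one_right (hA k j) (hle j)

open Matrix Polynomial in
/-- A constant row sum is an eigenvalue. -/
theorem isRoot_charpoly_of_rowSum {ι : Type*} [Fintype ι] [DecidableEq ι] [Nonempty ι]
    {A : Matrix ι ι ℝ} {r : ℝ} (hr : ∀ i, ∑ j, A i j = r) :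
    (A.map (algebraMap ℝ ℂ)).charpoly.IsRoot (r : ℂ) := by
  rw [IsRoot, eval_charpoly]
  refine exists_mulVec_eq_zero_iff.1 ⟨fun _ => 1, fun h => ?_, ?_⟩
  · simpa using congrFun h (Classical.arbitrary ι)
  · ext i
    have h1 : (A.map (algebraMap ℝ ℂ) *ᵥ fun _ => 1) i = (r : ℂ) := by
      rw [← hr i]
      simp [mulVec, dotProduct]
    rw [sub_mulVec, Pi.sub_apply, h1]
    simp [mulVec_diagonal]

/-! ### Characteristic polynomial of the bordered matrix -/

open Matrix Polynomial in
/-- The characteristic polynomial of a bordered matrix, evaluated by means of a solution `y` of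
`(x - A) y = b`. -/
theorem eval_charpoly_bordered {ι K : Type*} [Fintype ι] [DecidableEq ι] [Field K]
    {A : Matrix ι ι K} {b v y : ι → K} {a x : K} (hy : x • y - A *ᵥ y = b)
    (hx : A.charpoly.eval x ≠ 0) :
    (fromBlocks A (replicateCol Unit b) (replicateRow Unit v)
      (Matrix.of fun _ _ : Unit => a)).charpoly.eval x
      = A.charpoly.eval x * (x - a - v ⬝ᵥ y) := by
  rw [eval_charpoly] at hx ⊢
  rw [eval_charpoly]
  set M := scalar ι x - A with hM
  have hMy : M *ᵥ y = b := by
    rw [← hy, hM, sub_mulVec]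
    simp [scalar_apply, ← smul_one_eq_diagonal, smul_mulVec]
  let : Invertible M := invertibleOfIsUnitDet M (isUnit_iff_ne_zero.2 hx)
  have hinv : ⅟M *ᵥ b = y := by
    rw [← hMy, mulVec_mulVec, invOf_mul_self, one_mulVec]
  have hblocks : scalar (ι ⊕ Unit) x - fromBlocks A (replicateCol Unit b) (replicateRow Unit v)
      (Matrix.of fun _ _ : Unit => a)
      = fromBlocks M (-replicateCol Unit b) (-replicateRow Unit v)
        (Matrix.of fun _ _ : Unit => x - a) := by
    ext (i | i) (j | j) <;> simp [hM, scalar_apply, diagonal_apply]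
  rw [hblocks, det_fromBlocks₁₁]
  congr 1
  rw [det_unique, Matrix.mul_assoc, Matrix.neg_mul, Matrix.mul_neg, Matrix.mul_neg, neg_neg,
    ← replicateCol_mulVec, hinv]
  simp [replicateRow_mul_replicateCol_apply]

open Matrix in
/-- Realisability may be checked with a matrix indexed by any finite type. -/
theorem realisable_of_charpoly_roots_eq {ι : Type*} [Fintype ι] [DecidableEq ι]
    {A : Matrix ι ι ℝ} (hA : ∀ i j, 0 ≤ A i j) {σ : List ℂ}
    (h : (A.map (algebraMap ℝ ℂ)).charpoly.roots = (σ : Multiset ℂ)) : Realisable σ := by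
  refine ⟨Fintype.card ι, reindex (Fintype.equivFin ι) (Fintype.equivFin ι) A,
    fun i j => hA _ _, ?_⟩
  rw [← h, matrixSpectrum, ← charpoly_reindex (Fintype.equivFin ι) (A.map (algebraMap ℝ ℂ))]
  rfl

open Polynomial in
theorem quarticPoly_natDegree_monic (ρ α β a η t : ℝ) :
    (quarticPoly ρ α β a η t).natDegree = 4 ∧ (quarticPoly ρ α β a η t).Monic := by
  have h : (quarticPoly ρ α β a η t) = (X - C (a : ℂ)) * ((X - C (ρ : ℂ)) *
      ((X - C (α : ℂ)) ^ 2 + C (β : ℂ) ^ 2)) +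
      -(C (t : ℂ) * ((X - C (α : ℂ)) * ((1 + C (η : ℂ)) * X - C (α : ℂ) - C (η : ℂ) * C (ρ : ℂ))
        + C (β : ℂ) ^ 2)) := by
    rw [quarticPoly]; ring
  have hlow : (C (t : ℂ) * ((X - C (α : ℂ)) *
      ((1 + C (η : ℂ)) * X - C (α : ℂ) - C (η : ℂ) * C (ρ : ℂ)) + C (β : ℂ) ^ 2)).natDegree ≤ 2 := by
    rw [← C_1, ← C_add]
    compute_degree
  have hd : ((X - C (α : ℂ)) ^ 2 + C (β : ℂ) ^ 2).natDegree = 2 := by compute_degree!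
  have hm : ((X - C (α : ℂ)) ^ 2 + C (β : ℂ) ^ 2).Monic := by monicity!
  have hm4 := (monic_X_sub_C (a : ℂ)).mul ((monic_X_sub_C (ρ : ℂ)).mul hm)
  have hd4 : ((X - C (a : ℂ)) * ((X - C (ρ : ℂ)) *
      ((X - C (α : ℂ)) ^ 2 + C (β : ℂ) ^ 2))).natDegree = 4 := by
    rw [(monic_X_sub_C _).natDegree_mul ((monic_X_sub_C _).mul hm),
      (monic_X_sub_C _).natDegree_mul hm, natDegree_X_sub_C, natDegree_X_sub_C, hd]
  have hlt : (-(C (t : ℂ) * ((X - C (α : ℂ)) *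
      ((1 + C (η : ℂ)) * X - C (α : ℂ) - C (η : ℂ) * C (ρ : ℂ)) + C (β : ℂ) ^ 2))).natDegree
      < ((X - C (a : ℂ)) * ((X - C (ρ : ℂ)) *
      ((X - C (α : ℂ)) ^ 2 + C (β : ℂ) ^ 2))).natDegree := by
    rw [natDegree_neg, hd4]
    omega
  rw [h]
  exact ⟨by rw [natDegree_add_eq_left_of_natDegree_lt hlt, hd4],
    hm4.add_of_left (degree_lt_degree hlt)⟩

open Matrix Polynomial in
/-- Bordering a nonnegative matrix with constant row sums `ρ` by means of a complex eigenvector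
replaces the factor of `ρ, α ± iβ` in the characteristic polynomial by `quarticPoly`. -/
theorem exists_bordered_charpoly_eq {ι : Type*} [Fintype ι] [DecidableEq ι]
    {A : Matrix ι ι ℝ} (hA : ∀ i j, 0 ≤ A i j) {ρ α β : ℝ} (hr : ∀ i, ∑ j, A i j = ρ)
    {P : ℂ[X]} (hP : (A.map (algebraMap ℝ ℂ)).charpoly =
      (X - C (ρ : ℂ)) * ((X - C ((α : ℂ) + Complex.I * (β : ℂ))) *
        ((X - C ((α : ℂ) - Complex.I * (β : ℂ))) * P)))
    {a t η : ℝ} (ha : 0 ≤ a) (ht : 0 ≤ t) (hη0 : 0 ≤ η) (hη1 : η ≤ 1) :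
    ∃ B : Matrix (ι ⊕ Unit) (ι ⊕ Unit) ℝ, (∀ i j, 0 ≤ B i j) ∧
      (B.map (algebraMap ℝ ℂ)).charpoly = quarticPoly ρ α β a η t * P := by
  set A' := A.map (algebraMap ℝ ℂ) with hA'
  obtain ⟨z₀, hz₀, hAz₀⟩ := exists_eigenvector_of_isRoot_charpoly (A := A')
    (μ := (α : ℂ) + Complex.I * (β : ℂ)) (by simp [hP, IsRoot])
  obtain ⟨c, k, hk, hle⟩ := exists_smul_apply_eq_one hz₀
  set z := c • z₀
  have hAz : ∀ i, ∑ j, (A i j : ℂ) * z j = ((α : ℂ) + Complex.I * (β : ℂ)) * z i := fun i => by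
    have : A' *ᵥ z = ((α : ℂ) + Complex.I * (β : ℂ)) • z := by
      rw [mulVec_smul, hAz₀, smul_comm]
    exact congrFun this i
  have hAzc : ∀ i, ∑ j, (A i j : ℂ) * starRingEnd ℂ (z j)
      = ((α : ℂ) - Complex.I * (β : ℂ)) * starRingEnd ℂ (z i) := fun i => by
    have := congrArg (starRingEnd ℂ) (hAz i)
    simpa [map_sum, sub_eq_add_neg] using this
  have hA1 : ∀ i, ∑ j, (A i j : ℂ) = ρ := fun i => by rw [← hr i]; push_cast; rfl
  set B : Matrix (ι ⊕ Unit) (ι ⊕ Unit) ℝ := fromBlocks A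
    (replicateCol Unit fun i => 1 + η * (z i).re) (replicateRow Unit (Pi.single k t))
    (Matrix.of fun _ _ : Unit => a) with hB
  refine ⟨B, ?_, ?_⟩
  · rintro (i | i) (j | j)
    · exact hA i j
    · have h1 : |(z i).re| ≤ 1 := (Complex.abs_re_le_norm _).trans (hle i)
      have h2 := (abs_le.1 h1).1
      simp only [hB, fromBlocks_apply₁₂, replicateCol_apply]
      nlinarith
    · simp only [hB, fromBlocks_apply₂₁, replicateRow_apply, Pi.single_apply]
      split_ifs <;> simp [ht]
    · exact ha
  have hBmap : B.map (algebraMap ℝ ℂ) = fromBlocks A'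
      (replicateCol Unit fun i => 1 + (η : ℂ) * (z i).re)
      (replicateRow Unit (Pi.single k (t : ℂ))) (Matrix.of fun _ _ : Unit => (a : ℂ)) := by
    ext (i | i) (j | j) <;> simp [hB, hA', Pi.single_apply]
    split_ifs <;> simp
  -- Away from the finitely many eigenvalues of `A`, `x - A` is invertible and the Schur complement
  -- applies.
  refine eq_of_infinite_eval_eq _ _ (Set.Infinite.mono (s := {x | ¬ A'.charpoly.IsRoot x}) ?_
    (Set.Finite.infinite_compl (finite_setOfPred_isRoot (charpoly_monic A').ne_zero)))
  intro x (hx : A'.charpoly.eval x ≠ 0)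
  have hx' := hx
  rw [hP] at hx'
  simp only [eval_mul, eval_sub, eval_X, eval_C, mul_ne_zero_iff] at hx'
  obtain ⟨h1, h2, h3, -⟩ := hx'
  -- The column is `1 + (η/2)(z + z̄)`, and `z̄` is an eigenvector because `A` is real; `y` divides
  -- each component by `x` minus its eigenvalue.
  set y : ι → ℂ := fun i => (x - ρ)⁻¹ + η / 2 * ((x - (α + Complex.I * β))⁻¹ * z i
    + (x - (α - Complex.I * β))⁻¹ * starRingEnd ℂ (z i)) with hy
  have hAy : x • y - A' *ᵥ y = fun i => 1 + (η : ℂ) * (z i).re := by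
    ext i
    have hsum : (A' *ᵥ y) i = (x - ρ)⁻¹ * ∑ j, (A i j : ℂ) + η / 2 *
        ((x - (α + Complex.I * β))⁻¹ * ∑ j, (A i j : ℂ) * z j
        + (x - (α - Complex.I * β))⁻¹ * ∑ j, (A i j : ℂ) * starRingEnd ℂ (z j)) := by
      simp only [mulVec, dotProduct, Finset.mul_sum, ← Finset.sum_add_distrib]
      refine Finset.sum_congr rfl fun j _ => ?_
      simp only [hA', hy, map_apply, Complex.coe_algebraMap]
      ring
    rw [Pi.sub_apply, Pi.smul_apply, smul_eq_mul, hsum, hA1, hAz, hAzc, hy,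
      Complex.re_eq_add_conj]
    field_simp
    ring
  have hyk : y k = (x - ρ)⁻¹ + η / 2 * ((x - (α + Complex.I * β))⁻¹
      + (x - (α - Complex.I * β))⁻¹) := by
    simp only [hy, hk, map_one, mul_one]
  rw [Set.mem_ofPred_eq, hBmap, eval_charpoly_bordered hAy hx, single_dotProduct, hyk, hP]
  simp only [quarticPoly, eval_mul, eval_sub, eval_add, eval_pow, eval_X, eval_C, eval_one]
  -- Written with `b = iβ`, the identity becomes a rational one that no longer needs `I ^ 2 = -1`.
  have hβ2 : ((β : ℂ)) ^ 2 = -(Complex.I * β) ^ 2 := by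
    rw [mul_pow, Complex.I_sq]; ring
  rw [hβ2]
  generalize Complex.I * (β : ℂ) = b at *
  field_simp
  ring

/-! ### The main theorem -/

theorem mainTheorem2 (ρ α β : ℝ) (Λ : List ℂ) (hβ : 0 < β)
    (hσ : Realisable
      ((ρ : ℂ) :: ((α : ℂ) + Complex.I * (β : ℂ)) :: ((α : ℂ) - Complex.I * (β : ℂ)) :: Λ))
    (hρ : IsPerronEigenvalue ρ
      ((ρ : ℂ) :: ((α : ℂ) + Complex.I * (β : ℂ)) :: ((α : ℂ) - Complex.I * (β : ℂ)) :: Λ))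
    (a t η : ℝ) (ha : 0 ≤ a) (ht : 0 ≤ t) (hη0 : 0 < η) (hη1 : η ≤ 1) :
    (quarticPoly ρ α β a η t).roots.card = 4 ∧
    ∀ μ₁ μ₂ μ₃ μ₄ : ℂ,
      (quarticPoly ρ α β a η t).roots = ([μ₁, μ₂, μ₃, μ₄] : Multiset ℂ) →
      Realisable (μ₁ :: μ₂ :: μ₃ :: μ₄ :: Λ) := by
  obtain ⟨hdeg, hmonic⟩ := quarticPoly_natDegree_monic ρ α β a η t
  refine ⟨by rw [Polynomial.splits_iff_card_roots.1 (IsAlgClosed.splits _), hdeg], ?_⟩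
  intro μ₁ μ₂ μ₃ μ₄ hμ
  obtain ⟨n, A, hA, hspec⟩ := hσ
  rw [matrixSpectrum] at hspec
  have : Nonempty (Fin n) := by
    by_contra hn
    rw [not_nonempty_iff] at hn
    have hcard := congrArg Multiset.card hspec
    simp [Matrix.charpoly, Matrix.det_isEmpty] at hcard
  obtain ⟨A₁, r, hA₁, hr, hchar⟩ := exists_constant_rowSum_charpoly_eq A hA
  have hcharC : (A₁.map (algebraMap ℝ ℂ)).charpoly = (A.map (algebraMap ℝ ℂ)).charpoly := by
    rw [Matrix.charpoly_map, Matrix.charpoly_map, hchar]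
  have hmem : ∀ x, (A₁.map (algebraMap ℝ ℂ)).charpoly.IsRoot x ↔
      x ∈ ((ρ : ℂ) :: ((α : ℂ) + Complex.I * (β : ℂ)) ::
        ((α : ℂ) - Complex.I * (β : ℂ)) :: Λ) := fun x => by
    rw [hcharC, ← Polynomial.mem_roots (Matrix.charpoly_monic _).ne_zero, hspec, Multiset.mem_coe]
  -- `r` is an eigenvalue that bounds the modulus of all the others, and `ρ` has the same property.
  have hrρ : r = ρ := by
    refine le_antisymm ?_ ?_
    · have h := hρ.2 r ((hmem r).1 (isRoot_charpoly_of_rowSum hr))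
      rw [Complex.norm_real] at h
      exact (le_abs_self r).trans h
    · have h := norm_le_of_isRoot_charpoly_of_rowSum hA₁ hr ((hmem ρ).2 hρ.1)
      rw [Complex.norm_real] at h
      exact (le_abs_self ρ).trans h
  subst hrρ
  set P : Polynomial ℂ :=
    ((Λ : Multiset ℂ).map fun l => Polynomial.X - Polynomial.C l).prod with hPdef
  have hP : (A₁.map (algebraMap ℝ ℂ)).charpoly =
      (Polynomial.X - Polynomial.C (r : ℂ)) *
        ((Polynomial.X - Polynomial.C ((α : ℂ) + Complex.I * (β : ℂ))) *
        ((Polynomial.X - Polynomial.C ((α : ℂ) - Complex.I * (β : ℂ))) * P)) := by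
    rw [hcharC, (IsAlgClosed.splits _).eq_prod_roots_of_monic (Matrix.charpoly_monic _), hspec]
    simp [hPdef]
  have hPm : P.Monic := Polynomial.monic_multiset_prod_of_monic _ _
    fun l _ => Polynomial.monic_X_sub_C l
  obtain ⟨B, hB, hBchar⟩ := exists_bordered_charpoly_eq hA₁ hr hP ha ht hη0.le hη1
  refine realisable_of_charpoly_roots_eq hB ?_
  rw [hBchar, Polynomial.roots_mul (hmonic.mul hPm).ne_zero, hμ, hPdef,
    Polynomial.roots_multiset_prod_X_sub_C]
  rfl
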